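/- **Theorem (Pluzhnikov's theorem for skew-symmetric connections).** Let $(M,g)$ be a smooth finite-dimensional Riemannian manifold with Levi-Civita connection $\nabla^{g}$, and let $G$ be a finite-dimensional real Lie group with Lie algebra $\mathfrak g=T_eG$ and Maurer–Cartan form $\omega_G$, $(\omega_G)_h(v)=d(L_{h^{-1}})_h(v)\in\mathfrak g$. Let $\nabla^{G}$ be a left-invariant connection on $TG$, and let $\alpha:\mathfrak g\times\mathfrak g\to\mathfrak g$ be its connection function, i.e. the bilinear map $\alpha(v,w)=(\nabla^{G}_{X}Y)(e)$, where $X,Y$ are the left-invariant vector fields with $X(e)=v$, $Y(e)=w$. Assume that $\alpha$ is skew-symmetric: $\alpha(v,w)=-\alpha(w,v)$ for all $v,w\in\mathfrak g$. Let $F:M\to G$ be a smooth map. Its second fundamental form is $\beta_F(X,Y)=\nabla'_X(F_*Y)-F_*(\nabla^{g}_XY)$, where $\nabla'$ is the connection on the induced bundle $F^{-1}(TG)$ determined by $\nabla^G$ (the one with $\nabla'_v(Z\circ F)=\nabla^G_{F_*v}Z$), its tension field is $\tau_F=\operatorname{tr}_g\beta_F=\sum_i\beta_F(e_i,e_i)$,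 and $F$ is called harmonic if $\tau_F\equiv0$. For a $\mathfrak g$-valued $1$-form $\eta$ on $M$ let $d^{*}\eta=-\sum_i(\nabla^{g}_{e_i}\eta)(e_i)$, where $(\nabla^g_X\eta)(Y)=X(\eta(Y))-\eta(\nabla^g_XY)$; here $(e_i)$ is any orthonormal basis of the tangent space in question. Then $$F\ \text{is harmonic}\quad\Longleftrightarrow\quad d^{*}F^{*}\omega_G=0 \ \text{ on } M.$$ -/

import Mathlib

open Bundle FiberBundle VectorField
open scoped Manifold ContDiff

namespace Pluzhnikov

noncomputable section

instance finiteDimensional_tangentSpace {E : Type*} [NormedAddCommGroup E] [NormedSpace ℝ E]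
    [FiniteDimensional ℝ E] {H : Type*} [TopologicalSpace H] (I : ModelWithCorners ℝ E H)
    {M : Type*} [TopologicalSpace M] [ChartedSpace H M] (x : M) :
    FiniteDimensional ℝ (TangentSpace I x) :=
  inferInstanceAs (FiniteDimensional ℝ E)

section LeviCivita

variable {E : Type*} [NormedAddCommGroup E] [NormedSpace ℝ E]
  {H : Type*} [TopologicalSpace H] (I : ModelWithCorners ℝ E H)
  {M : Type*} [TopologicalSpace M] [ChartedSpace H M]
  [RiemannianBundle (fun x : M => TangentSpace I x)]

/-- The right-hand side of Koszul's formula for `2 ⟨∇_X Y, Z⟩`. -/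
def koszul (Y X Z : Π x : M, TangentSpace I x) (x : M) : ℝ :=
  mvfderiv I (fun y => inner ℝ (Y y) (Z y)) x (X x)
    + mvfderiv I (fun y => inner ℝ (X y) (Z y)) x (Y x)
    - mvfderiv I (fun y => inner ℝ (X y) (Y y)) x (Z x)
    + inner ℝ (mlieBracket I X Y x) (Z x)
    - inner ℝ (mlieBracket I X Z x) (Y x)
    - inner ℝ (mlieBracket I Y Z x) (X x)

variable [IsManifold I ∞ M] [IsContMDiffRiemannianBundle I ∞ E (fun x : M => TangentSpace I x)]

theorem mdiffAt_inner {x : M} {X Y : Π x : M, TangentSpace I x}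
    (hX : MDiffAt (T% X) x) (hY : MDiffAt (T% Y) x) :
    MDiffAt (fun y => inner ℝ (X y) (Y y)) x :=
  MDifferentiableAt.inner_bundle (F := E) (E := fun x : M => TangentSpace I x) (b := id) hX hY

variable [FiniteDimensional ℝ E]

theorem tensorialAt_koszul₁ {x : M} {Y Z : Π x : M, TangentSpace I x}
    (hY : MDiffAt (T% Y) x) (hZ : MDiffAt (T% Z) x) :
    TensorialAt I E (fun X => koszul I Y X Z x) x where
  smul {f X} hf hX := by
    have := FiniteDimensional.complete ℝ E
    simp [koszul, mvfderiv_fun_mul hf (mdiffAt_inner I hX hZ), mvfderiv_fun_mul hf (mdiffAt_inner I hX hY),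
      mlieBracket_smul_left hf hX, inner_add_left, inner_smul_left, inner_smul_right]
    ring
  add {X X'} hX hX' := by
    have := FiniteDimensional.complete ℝ E
    simp [koszul, mvfderiv_fun_add (mdiffAt_inner I hX hZ) (mdiffAt_inner I hX' hZ),
      mvfderiv_fun_add (mdiffAt_inner I hX hY) (mdiffAt_inner I hX' hY),
      mlieBracket_add_left hX hX', inner_add_left, inner_add_right]
    ring

theorem tensorialAt_koszul₂ {x : M} {Y X : Π x : M, TangentSpace I x}
    (hY : MDiffAt (T% Y) x) (hX : MDiffAt (T% X) x) :
    TensorialAt I E (fun Z => koszul I Y X Z x) x where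
  smul {f Z} hf hZ := by
    have := FiniteDimensional.complete ℝ E
    simp [koszul, mvfderiv_fun_mul hf (mdiffAt_inner I hX hZ), mvfderiv_fun_mul hf (mdiffAt_inner I hY hZ),
      mlieBracket_smul_right hf hZ, inner_add_left, inner_smul_left, inner_smul_right,
      real_inner_comm]
    ring
  add {Z Z'} hZ hZ' := by
    have := FiniteDimensional.complete ℝ E
    simp [koszul, mvfderiv_fun_add (mdiffAt_inner I hX hZ) (mdiffAt_inner I hX hZ'),
      mvfderiv_fun_add (mdiffAt_inner I hY hZ) (mdiffAt_inner I hY hZ'),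
      mlieBracket_add_right hZ hZ', inner_add_left, inner_add_right]
    ring

/-- Koszul's expression at `x` as a bilinear form in `(X x, Z x)`, for `Y` differentiable at `x`. -/
def koszulForm (Y : Π x : M, TangentSpace I x) (x : M) (hY : MDiffAt (T% Y) x) :
    TangentSpace I x →L[ℝ] TangentSpace I x →L[ℝ] ℝ :=
  TensorialAt.mkHom₂ (fun X Z => koszul I Y X Z x) x
    (fun _ hZ => tensorialAt_koszul₁ I hY hZ) (fun _ hX => tensorialAt_koszul₂ I hY hX)

open Classical in
/-- `leviCivitaFun I Y x v` is `∇_v Y` at `x`: the vector determined by Koszul's formula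
(`0` by convention when `Y` is not differentiable at `x`). -/
def leviCivitaFun (Y : Π x : M, TangentSpace I x) (x : M) :
    TangentSpace I x →L[ℝ] TangentSpace I x :=
  if hY : MDiffAt (T% Y) x then
    LinearMap.toContinuousLinearMap
      { toFun := fun v =>
          (InnerProductSpace.toDual ℝ (TangentSpace I x)).symm ((1 / 2 : ℝ) • koszulForm I Y x hY v)
        map_add' := by intro v w; simp
        map_smul' := by intro c v; simp only [map_smul, RingHom.id_apply]; rw [smul_comm] }
  else 0

theorem inner_leviCivitaFun {x : M} {Y X Z : Π x : M, TangentSpace I x}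
    (hY : MDiffAt (T% Y) x) (hX : MDiffAt (T% X) x) (hZ : MDiffAt (T% Z) x) :
    inner ℝ (leviCivitaFun I Y x (X x)) (Z x) = (1 / 2 : ℝ) * koszul I Y X Z x := by
  have h := TensorialAt.mkHom₂_apply (Φ := fun X Z => koszul I Y X Z x)
    (fun _ hZ => tensorialAt_koszul₁ I hY hZ) (fun _ hX => tensorialAt_koszul₂ I hY hX) hX hZ
  simp [leviCivitaFun, hY, koszulForm, h, inner_smul_left]

/-- The Levi-Civita connection of the Riemannian manifold `M`. -/
def leviCivita : CovariantDerivative I E (fun x : M => TangentSpace I x) where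
  toFun := leviCivitaFun I
  isCovariantDerivativeOnUniv :=
    { add := by
        intro Y Y' x hY hY' _
        have := FiniteDimensional.complete ℝ E
        ext1 v
        refine ext_inner_right ℝ fun w => ?_
        have hv := mdifferentiableAt_extend I E v
        have hw := mdifferentiableAt_extend I E w
        have h1 := inner_leviCivitaFun I (mdifferentiableAt_add_section hY hY') hv hw
        have h2 := inner_leviCivitaFun I hY hv hw
        have h3 := inner_leviCivitaFun I hY' hv hw
        simp only [extend_apply_self] at h1 h2 h3
        rw [add_apply, inner_add_left, h1, h2, h3]
        simp [koszul, mvfderiv_fun_add (mdiffAt_inner I hY hw) (mdiffAt_inner I hY' hw),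
          mvfderiv_fun_add (mdiffAt_inner I hv hY) (mdiffAt_inner I hv hY'),
          mlieBracket_add_right hY hY', mlieBracket_add_left hY hY', inner_add_left,
          inner_add_right]
        ring
      leibniz := by
        intro Y g x hY hg _
        have := FiniteDimensional.complete ℝ E
        ext1 v
        refine ext_inner_right ℝ fun w => ?_
        have hv := mdifferentiableAt_extend I E v
        have hw := mdifferentiableAt_extend I E w
        have h1 := inner_leviCivitaFun I (hg.smul_section hY) hv hw
        have h2 := inner_leviCivitaFun I hY hv hw
        simp only [extend_apply_self] at h1 h2
        rw [h1]
        simp [koszul, mvfderiv_fun_mul hg (mdiffAt_inner I hY hw),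
          mvfderiv_fun_mul hg (mdiffAt_inner I hY hv), mlieBracket_smul_right hg hY,
          mlieBracket_smul_left hg hY, inner_add_left, inner_smul_left, inner_smul_right, h2,
          real_inner_comm]
        ring }

/-- The Levi-Civita connection is torsion-free. -/
theorem torsion_leviCivita :
    haveI := FiniteDimensional.complete ℝ E
    (leviCivita I (M := M)).torsion = 0 := by
  have := FiniteDimensional.complete ℝ E
  rw [CovariantDerivative.torsion_eq_zero_iff]
  intro X Y x hX hY
  refine ext_inner_right ℝ fun w => ?_
  have hw := mdifferentiableAt_extend I E w
  have h1 := inner_leviCivitaFun I hY hX hw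
  have h2 := inner_leviCivitaFun I hX hY hw
  simp only [extend_apply_self] at h1 h2
  rw [inner_sub_left]
  change inner ℝ (leviCivitaFun I Y x (X x)) w - inner ℝ (leviCivitaFun I X x (Y x)) w = _
  rw [h1, h2]
  simp [koszul, mlieBracket_swap_apply (V := Y) (W := X), real_inner_comm]
  ring

/-- The Levi-Civita connection is compatible with the metric. -/
theorem mvfderiv_inner_leviCivita {x : M} {X Y Z : Π x : M, TangentSpace I x}
    (hX : MDiffAt (T% X) x) (hY : MDiffAt (T% Y) x) (hZ : MDiffAt (T% Z) x) :
    mvfderiv I (fun y => inner ℝ (Y y) (Z y)) x (X x) =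
      inner ℝ (leviCivita I Y x (X x)) (Z x) + inner ℝ (Y x) (leviCivita I Z x (X x)) := by
  have h1 := inner_leviCivitaFun I hY hX hZ
  have h2 := inner_leviCivitaFun I hZ hX hY
  rw [real_inner_comm _ (Y x)]
  change _ = inner ℝ (leviCivitaFun I Y x (X x)) (Z x) + inner ℝ (leviCivitaFun I Z x (X x)) (Y x)
  rw [h1, h2]
  simp [koszul, mlieBracket_swap_apply (V := Z) (W := Y), real_inner_comm]
  ring

end LeviCivita
section Pullback

variable {E : Type*} [NormedAddCommGroup E] [NormedSpace ℝ E]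
  {H : Type*} [TopologicalSpace H] (I : ModelWithCorners ℝ E H)
  {M : Type*} [TopologicalSpace M] [ChartedSpace H M]
  {E' : Type*} [NormedAddCommGroup E'] [NormedSpace ℝ E']
  {H' : Type*} [TopologicalSpace H'] {J : ModelWithCorners ℝ E' H'}
  {N : Type*} [TopologicalSpace N] [ChartedSpace H' N] [IsManifold J ∞ N]

/-- The coordinates, near `x`, of a vector field `U` along `F : M → N` (a section of the induced
bundle `F⁻¹(TN)`) in the trivialization of `TN` around `F x`. -/
def fieldCoord (F : M → N) (x : M) (U : Π y : M, TangentSpace J (F y)) (y : M) : E' :=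
  (trivializationAt E' (fun z : N => TangentSpace J z) (F x) ⟨F y, U y⟩).2

/-- The connection on the induced bundle `F⁻¹(TN)` given by a connection on `N`. Writing
`U = ∑ uⁱ (e_i ∘ F)` in the local frame `e_i` of `TN` around `F x`, it is
`∇'_v U = ∑ duⁱ(v) e_i + uⁱ(x) ∇_{dF v} e_i`; here `∑ uⁱ(x) e_i` is `extend E' (U x)`.
See `pullbackConnection_add`, `pullbackConnection_smul`, `pullbackConnection_comp`. -/
def pullbackConnection (cov : CovariantDerivative J E' (fun z : N => TangentSpace J z))
    (F : M → N) (U : Π y : M, TangentSpace J (F y)) (x : M) :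
    TangentSpace I x →L[ℝ] TangentSpace J (F x) :=
  (trivializationAt E' (fun z : N => TangentSpace J z) (F x)).symmL ℝ (F x) ∘L
      mvfderiv I (fieldCoord F x U) x
    + cov (extend E' (U x)) (F x) ∘L mfderiv I J F x

variable {I}

theorem mdiffAt_fieldCoord {F : M → N} {U : Π y : M, TangentSpace J (F y)} {x : M}
    (hU : MDifferentiableAt I J.tangent (fun y => (⟨F y, U y⟩ : TangentBundle J N)) x) :
    MDiffAt (fieldCoord F x U) x :=
  ((mdifferentiableAt_totalSpace (E := fun z : N => TangentSpace J z) J _).1 hU).2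

theorem mdiffAt_base {F : M → N} {U : Π y : M, TangentSpace J (F y)} {x : M}
    (hU : MDifferentiableAt I J.tangent (fun y => (⟨F y, U y⟩ : TangentBundle J N)) x) :
    MDifferentiableAt I J F x :=
  ((mdifferentiableAt_totalSpace (E := fun z : N => TangentSpace J z) J _).1 hU).1

theorem fieldCoord_add_eventuallyEq {F : M → N} {x : M} (hF : ContinuousAt F x)
    (U U' : Π y : M, TangentSpace J (F y)) :
    fieldCoord F x (U + U') =ᶠ[nhds x] fieldCoord F x U + fieldCoord F x U' := by
  set e := trivializationAt E' (fun z : N => TangentSpace J z) (F x) with he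
  have : ∀ᶠ y in nhds x, F y ∈ e.baseSet :=
    hF.eventually (e.open_baseSet.mem_nhds (mem_baseSet_trivializationAt E' _ (F x)))
  filter_upwards [this] with y hy
  exact (e.linear ℝ hy).1 ..

theorem fieldCoord_smul_eventuallyEq {F : M → N} {x : M} (hF : ContinuousAt F x) (g : M → ℝ)
    (U : Π y : M, TangentSpace J (F y)) :
    fieldCoord F x (fun y => g y • U y) =ᶠ[nhds x] g • fieldCoord F x U := by
  set e := trivializationAt E' (fun z : N => TangentSpace J z) (F x) with he
  have : ∀ᶠ y in nhds x, F y ∈ e.baseSet :=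
    hF.eventually (e.open_baseSet.mem_nhds (mem_baseSet_trivializationAt E' _ (F x)))
  filter_upwards [this] with y hy
  exact (e.linear ℝ hy).2 ..

set_option linter.unusedSectionVars false in
theorem symmL_fieldCoord (F : M → N) (U : Π y : M, TangentSpace J (F y)) (x : M) :
    (trivializationAt E' (fun z : N => TangentSpace J z) (F x)).symmL ℝ (F x)
      (fieldCoord F x U x) = U x := by
  have h := mem_baseSet_trivializationAt E' (fun z : N => TangentSpace J z) (F x)
  rw [Trivialization.symmL_apply _ h]
  exact Trivialization.symm_apply_apply_mk _ h _

theorem mvfderiv_congr {u v : M → E'} {x : M}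
    (h : u =ᶠ[nhds x] v) : mvfderiv I u x = mvfderiv I v x := by
  ext w
  have := h.mfderiv_eq (I := I) (I' := 𝓘(ℝ, E'))
  simp only [mvfderiv, this, ContinuousLinearMap.comp_apply]
  rfl

variable (cov : CovariantDerivative J E' (fun z : N => TangentSpace J z))

/-- The difference at `p` of the connection and of the flat connection of the trivialization
around `p`. -/
def christoffelAux (p : N) (Z : Π z : N, TangentSpace J z) :
    TangentSpace J p →L[ℝ] TangentSpace J p :=
  cov Z p - (trivializationAt E' (fun z : N => TangentSpace J z) p).symmL ℝ p ∘L
      mvfderiv J (fieldCoord (fun z : N => z) p Z) p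

theorem tensorialAt_christoffelAux (p : N) :
    TensorialAt J E' (christoffelAux cov p) p where
  smul {g Z} hg hZ := by
    have hz := mdiffAt_fieldCoord (F := fun z : N => z) hZ
    have h1 := mvfderiv_congr (I := J) (fieldCoord_smul_eventuallyEq (F := fun z : N => z) (x := p) continuousAt_id g
      Z)
    have h2 := symmL_fieldCoord (fun z : N => z) Z p
    have h3 : fieldCoord (fun z : N => z) p (g • Z) =
      fieldCoord (fun z : N => z) p (fun y => g y • Z y) := rfl
    simp only [christoffelAux]
    rw [cov.isCovariantDerivativeOnUniv.leibniz hZ hg, h3, h1, mvfderiv_smul hg hz]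
    ext w
    simp [h2]
    module
  add {Z Z'} hZ hZ' := by
    have hz := mdiffAt_fieldCoord (F := fun z : N => z) hZ
    have hz' := mdiffAt_fieldCoord (F := fun z : N => z) hZ'
    have h1 := mvfderiv_congr (I := J) (fieldCoord_add_eventuallyEq (F := fun z : N => z) (x := p) continuousAt_id Z
      Z')
    simp only [christoffelAux]
    rw [cov.isCovariantDerivativeOnUniv.add hZ hZ', h1, mvfderiv_add hz hz']
    ext w
    simp
    module

theorem christoffelAux_extend (p : N) (v : TangentSpace J p) :
    christoffelAux cov p (extend E' v) = cov (extend E' v) p := by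
  set e := trivializationAt E' (fun z : N => TangentSpace J z) p with he
  have h : fieldCoord (fun z : N => z) p (extend E' v) =ᶠ[nhds p] fun _ => (e ⟨p, v⟩).2 := by
    filter_upwards [e.open_baseSet.mem_nhds (mem_baseSet_trivializationAt E' _ p)] with y hy
    simp [fieldCoord, extend, ← he, hy]
  rw [christoffelAux, mvfderiv_congr h, mvfderiv_const]
  simp

variable [FiniteDimensional ℝ E']

/-- The Christoffel tensor at `p` of the connection in the trivialization around `p`. -/
def christoffel (p : N) : TangentSpace J p →L[ℝ] TangentSpace J p →L[ℝ] TangentSpace J p :=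
  TensorialAt.mkHom (christoffelAux cov p) p (tensorialAt_christoffelAux cov p)

theorem cov_extend (p : N) (v : TangentSpace J p) :
    cov (extend E' v) p = christoffel cov p v := by
  rw [← christoffelAux_extend]
  rfl

variable {cov}

theorem pullbackConnection_add {F : M → N} {U U' : Π y : M, TangentSpace J (F y)} {x : M}
    (hU : MDifferentiableAt I J.tangent (fun y => (⟨F y, U y⟩ : TangentBundle J N)) x)
    (hU' : MDifferentiableAt I J.tangent (fun y => (⟨F y, U' y⟩ : TangentBundle J N)) x) :
    pullbackConnection I cov F (U + U') x =
      pullbackConnection I cov F U x + pullbackConnection I cov F U' x := by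
  have hF := (mdiffAt_base hU).continuousAt
  simp only [pullbackConnection, cov_extend, mvfderiv_congr (fieldCoord_add_eventuallyEq hF U U'),
    mvfderiv_add (mdiffAt_fieldCoord hU) (mdiffAt_fieldCoord hU')]
  ext w
  simp
  module

theorem pullbackConnection_smul {F : M → N} {g : M → ℝ} {U : Π y : M, TangentSpace J (F y)} {x : M}
    (hg : MDiffAt g x)
    (hU : MDifferentiableAt I J.tangent (fun y => (⟨F y, U y⟩ : TangentBundle J N)) x) :
    pullbackConnection I cov F (fun y => g y • U y) x =
      g x • pullbackConnection I cov F U x + (mvfderiv I g x).smulRight (U x) := by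
  have hF := (mdiffAt_base hU).continuousAt
  have h2 := symmL_fieldCoord F U x
  simp only [pullbackConnection, cov_extend, mvfderiv_congr (fieldCoord_smul_eventuallyEq hF g U),
    mvfderiv_smul hg (mdiffAt_fieldCoord hU)]
  ext w
  simp [h2]
  module

/-- The characteristic property of the induced connection: `∇'_v (Z ∘ F) = ∇_{dF v} Z`. -/
theorem pullbackConnection_comp {F : M → N} {Z : Π z : N, TangentSpace J z} {x : M}
    (hF : MDifferentiableAt I J F x) (hZ : MDiffAt (T% Z) (F x)) :
    pullbackConnection I cov F (fun y => Z (F y)) x = cov Z (F x) ∘L mfderiv I J F x := by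
  have h := TensorialAt.mkHom_apply (tensorialAt_christoffelAux cov (F x)) hZ
  have hz := mdiffAt_fieldCoord (F := fun z : N => z) hZ
  have hc : mvfderiv I (fieldCoord (fun z : N => z) (F x) Z ∘ F) x =
      mvfderiv J (fieldCoord (fun z : N => z) (F x) Z) (F x) ∘L mfderiv I J F x := by
    simp only [mvfderiv]
    rw [mfderiv_comp x hz hF]
    rfl
  have hc' : fieldCoord F x (fun y => Z (F y)) = fieldCoord (fun z : N => z) (F x) Z ∘ F := rfl
  rw [pullbackConnection, cov_extend, christoffel, h, hc', hc, christoffelAux]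
  ext w
  simp

end Pullback

section Tension
variable {E : Type*} [NormedAddCommGroup E] [NormedSpace ℝ E]
  {H : Type*} [TopologicalSpace H] {I : ModelWithCorners ℝ E H}
  {M : Type*} [TopologicalSpace M] [ChartedSpace H M]
  {E' : Type*} [NormedAddCommGroup E'] [NormedSpace ℝ E']
  {H' : Type*} [TopologicalSpace H'] {J : ModelWithCorners ℝ E' H'}
  {N : Type*} [TopologicalSpace N] [ChartedSpace H' N] [IsManifold J ∞ N] [IsManifold I ∞ M]

/-- The second fundamental form `β_F(X, Y) = ∇'_X (F_* Y) - F_* (∇_X Y)` of `F : M → N`. -/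
def secondFundamentalForm (covM : CovariantDerivative I E (fun x : M => TangentSpace I x))
    (covN : CovariantDerivative J E' (fun z : N => TangentSpace J z)) (F : M → N)
    (X Y : Π x : M, TangentSpace I x) (x : M) : TangentSpace J (F x) :=
  pullbackConnection I covN F (fun y => mfderiv I J F y (Y y)) x (X x)
    - mfderiv I J F x (covM Y x (X x))

theorem mdiffAt_mfderiv_apply {F : M → N} (hF : ContMDiff I J ∞ F)
    {Y : Π x : M, TangentSpace I x} {x : M} (hY : MDiffAt (T% Y) x) :
    MDifferentiableAt I J.tangent
      (fun y => (⟨F y, mfderiv I J F y (Y y)⟩ : TangentBundle J N)) x := by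
  have h : ContMDiff I.tangent J.tangent 1 (tangentMap I J F) :=
    hF.contMDiff_tangentMap (by rw [one_add_one_eq_two]; exact ENat.LEInfty.out)
  exact (h.mdifferentiableAt (by simp)).comp x hY

theorem tensorialAt_secondFundamentalForm [FiniteDimensional ℝ E']
    (covM : CovariantDerivative I E (fun x : M => TangentSpace I x))
    (covN : CovariantDerivative J E' (fun z : N => TangentSpace J z)) {F : M → N}
    (hF : ContMDiff I J ∞ F) (X : Π x : M, TangentSpace I x) (x : M) :
    TensorialAt I E (fun Y => secondFundamentalForm covM covN F X Y x) x where
  smul {g Y} hg hY := by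
    have h := pullbackConnection_smul (cov := covN) hg (mdiffAt_mfderiv_apply hF hY)
    simp only [secondFundamentalForm, covM.isCovariantDerivativeOnUniv.leibniz hY hg]
    have e : (fun y => mfderiv I J F y ((g • Y) y)) = fun y => g y • mfderiv I J F y (Y y) := by
      ext y; simp
    rw [e, h]
    simp
    module
  add {Y Y'} hY hY' := by
    have h := pullbackConnection_add (cov := covN) (mdiffAt_mfderiv_apply hF hY)
      (mdiffAt_mfderiv_apply hF hY')
    simp only [secondFundamentalForm, covM.isCovariantDerivativeOnUniv.add hY hY']
    have e : (fun y => mfderiv I J F y ((Y + Y') y)) =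
        (fun y => mfderiv I J F y (Y y)) + fun y => mfderiv I J F y (Y' y) := by
      ext y; simp
    rw [e, h]
    simp
    module
variable (I) [RiemannianBundle (fun x : M => TangentSpace I x)]
  [IsContMDiffRiemannianBundle I ∞ E (fun x : M => TangentSpace I x)] [FiniteDimensional ℝ E]

/-- The tension field `τ_F = tr β_F` of a map `F` from a Riemannian manifold `M`, with its
Levi-Civita connection, to a manifold `N` with a connection. The trace at `x` is computed in an
orthonormal basis of `T_x M`, whose vectors are extended to vector fields near `x`
(`β_F` being tensorial, the extension is immaterial). -/
def tensionField (covN : CovariantDerivative J E' (fun z : N => TangentSpace J z)) (F : M → N)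
    (x : M) : TangentSpace J (F x) :=
  let e := stdOrthonormalBasis ℝ (TangentSpace I x)
  ∑ i, secondFundamentalForm (leviCivita I) covN F (extend E (e i)) (extend E (e i)) x

/-- A map is harmonic if its tension field vanishes identically. -/
def IsHarmonic (covN : CovariantDerivative J E' (fun z : N => TangentSpace J z)) (F : M → N) :
    Prop :=
  ∀ x : M, tensionField I covN F x = 0

end Tension

section Codifferential

variable {E : Type*} [NormedAddCommGroup E] [NormedSpace ℝ E]
  {H : Type*} [TopologicalSpace H] {I : ModelWithCorners ℝ E H}
  {M : Type*} [TopologicalSpace M] [ChartedSpace H M] [IsManifold I ∞ M]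
  {V : Type*} [NormedAddCommGroup V] [NormedSpace ℝ V]

/-- The covariant derivative `(∇_X η)(Y) = X(η(Y)) - η(∇_X Y)` of a `V`-valued 1-form `η`. -/
def covDerivOneForm (cov : CovariantDerivative I E (fun x : M => TangentSpace I x))
    (η : Π x : M, TangentSpace I x →L[ℝ] V) (X Y : Π x : M, TangentSpace I x) (x : M) : V :=
  mvfderiv I (fun y => η y (Y y)) x (X x) - η x (cov Y x (X x))

theorem tensorialAt_covDerivOneForm
    (cov : CovariantDerivative I E (fun x : M => TangentSpace I x))
    {η : Π x : M, TangentSpace I x →L[ℝ] V} {x : M}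
    (hη : ∀ Y : Π x : M, TangentSpace I x, MDiffAt (T% Y) x → MDiffAt (fun y => η y (Y y)) x)
    (X : Π x : M, TangentSpace I x) :
    TensorialAt I E (fun Y => covDerivOneForm cov η X Y x) x where
  smul {g Y} hg hY := by
    have e : (fun y => η y ((g • Y) y)) = g • fun y => η y (Y y) := by
      ext y; simp
    simp only [covDerivOneForm, cov.isCovariantDerivativeOnUniv.leibniz hY hg]
    rw [e, mvfderiv_smul hg (hη Y hY)]
    simp
    module
  add {Y Y'} hY hY' := by
    have e : (fun y => η y ((Y + Y') y)) = (fun y => η y (Y y)) + fun y => η y (Y' y) := by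
      ext y; simp
    simp only [covDerivOneForm, cov.isCovariantDerivativeOnUniv.add hY hY']
    rw [e, mvfderiv_add (hη Y hY) (hη Y' hY')]
    simp
    module

variable (I) [RiemannianBundle (fun x : M => TangentSpace I x)]
  [IsContMDiffRiemannianBundle I ∞ E (fun x : M => TangentSpace I x)] [FiniteDimensional ℝ E]

/-- The codifferential `d^* η = - ∑ (∇_{e_i} η)(e_i)` of a `V`-valued 1-form on a Riemannian
manifold, `∇` being the Levi-Civita connection and `e_i` an orthonormal basis of `T_x M`, extended
to vector fields near `x` (the extension is immaterial, `∇η` being tensorial). -/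
def codifferential (η : Π x : M, TangentSpace I x →L[ℝ] V) (x : M) : V :=
  let e := stdOrthonormalBasis ℝ (TangentSpace I x);
  -∑ i, covDerivOneForm (leviCivita I) η (extend E (e i)) (extend E (e i)) x

end Codifferential

section LieGroup

variable {E : Type*} [NormedAddCommGroup E] [NormedSpace ℝ E]
  {H : Type*} [TopologicalSpace H] {J : ModelWithCorners ℝ E H}
  {G : Type*} [TopologicalSpace G] [ChartedSpace H G] [Group G]

variable (J) in
/-- The Maurer-Cartan form `ω_g(v) = d(L_{g⁻¹})_g v ∈ T_1 G = 𝔤`. -/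
def maurerCartan (g : G) : TangentSpace J g →L[ℝ] GroupLieAlgebra J G :=
  mfderiv J J (fun h : G => g⁻¹ * h) g

variable [LieGroup J ∞ G]

/-- A connection on `TG` is left invariant if every left translation `L_g` preserves it:
`(L_g)_* (∇_v (L_g^* Y)) = ∇_{(L_g)_* v} Y` for all smooth vector fields `Y` and tangent
vectors `v`. -/
def IsLeftInvariant
    (cov : CovariantDerivative J E (fun g : G => TangentSpace J g)) : Prop :=
  ∀ (g : G) (Y : Π h : G, TangentSpace J h), CMDiff ∞ (T% Y) →
    ∀ (h : G) (v : TangentSpace J h),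
      mfderiv J J (fun k : G => g * k) h (cov (mpullback J J (fun k : G => g * k) Y) h v) =
        cov Y (g * h) (mfderiv J J (fun k : G => g * k) h v)

theorem mdiffAt_mulInvariantVectorField (v : GroupLieAlgebra J G) (g : G) :
    MDiffAt (T% (mulInvariantVectorField v)) g := by
  have : LieGroup J (minSmoothness ℝ 3) G := by
    apply LieGroup.of_le (n := ∞)
    simp only [minSmoothness_of_isRCLikeNormedField]
    exact ENat.LEInfty.out
  exact mdifferentiableAt_mulInvariantVectorField v

/-- The connection function `α : 𝔤 × 𝔤 → 𝔤` of a connection on `G`: `α(v, w)` is the value at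
the identity of `∇_X Y`, where `X` and `Y` are the left invariant vector fields with values `v`
and `w` at the identity. -/
def connectionFunction
    (cov : CovariantDerivative J E (fun g : G => TangentSpace J g)) :
    GroupLieAlgebra J G →ₗ[ℝ] GroupLieAlgebra J G →ₗ[ℝ] GroupLieAlgebra J G :=
  LinearMap.mk₂ ℝ
    (fun v w => cov (mulInvariantVectorField w) 1 (mulInvariantVectorField v 1))
    (fun v v' w => by rw [mulInvariantVectorField_add, Pi.add_apply, map_add])
    (fun c v w => by rw [mulInvariantVectorField_smul, Pi.smul_apply, map_smul])
    (fun v w w' => by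
      rw [mulInvariantVectorField_add, cov.isCovariantDerivativeOnUniv.add
        (mdiffAt_mulInvariantVectorField w 1) (mdiffAt_mulInvariantVectorField w' 1), add_apply])
    (fun c v w => by
      rw [mulInvariantVectorField_smul, cov.isCovariantDerivativeOnUniv.smul_const c
        (mdiffAt_mulInvariantVectorField w 1), smul_apply])

end LieGroup

end

end Pluzhnikov

/-!
The proof identifies every tangent space of `G` with `𝔤` by left translation. Put `η = F^* ω_G`.
Then `F_* Y` at `y` is the value at `F y` of the left-invariant field generated by `η(Y)`, so in
terms of a basis `b_i` of `𝔤` and the left-invariant fields `B_i` it generates,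
`F_* Y = ∑ η^i(Y) • (B_i ∘ F)`. Left invariance of the connection says that
`∇_{X_v} X_w = X_{α(v, w)}` at every point, `X_v` being the left-invariant field with value `v` at
the identity (`cov_mulInvariantVectorField`). The Leibniz rule and the characteristic property of
the induced connection then give
`∇'_v (F_* Y) = dL_{F x} (v(η(Y)) + α(η(v), η(Y)))`
(`pullbackConnection_mulInvariantVectorField`), and therefore
`β_F(X, Y) = dL_{F x} ((∇_X η)(Y) + α(η(X), η(Y)))` (`secondFundamentalForm_eq`).

In the trace the second term disappears, because a skew-symmetric `α` vanishes on the diagonal. So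
`τ_F = -dL_{F x} (d^* η)` (`tensionField_eq`), and `dL_{F x}` is injective, with the Maurer-Cartan
form as its inverse.
-/

namespace Pluzhnikov

/-! ### Left translations, left-invariant fields and the Maurer-Cartan form -/

section
variable {E' : Type*} [NormedAddCommGroup E'] [NormedSpace ℝ E']
  {H' : Type*} [TopologicalSpace H'] {J : ModelWithCorners ℝ E' H'}
  {G : Type*} [TopologicalSpace G] [ChartedSpace H' G]

/-- Tangent vectors at propositionally equal points can be compared through the model space, of
which all tangent spaces are copies. -/
theorem tangentBundle_mk_congr {g h : G} (e : g = h) (u : E') :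
    (⟨g, u⟩ : TangentBundle J G) = ⟨h, u⟩ := by
  subst e
  rfl

end

section
variable {E' : Type*} [NormedAddCommGroup E'] [NormedSpace ℝ E']
  {H' : Type*} [TopologicalSpace H'] {J : ModelWithCorners ℝ E' H'}
  {G : Type*} [TopologicalSpace G] [ChartedSpace H' G] [Group G] [LieGroup J ∞ G]

theorem mdifferentiableAt_mul_left (g h : G) :
    MDifferentiableAt J J (fun k : G => g * k) h :=
  (contMDiff_mul_left (I := J) (n := ∞)).mdifferentiableAt (by simp)

theorem mulInvariantVectorField_maurerCartan (g : G) (v : TangentSpace J g) :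
    mulInvariantVectorField (maurerCartan J g v) g = v := by
  have h : (fun k : G => g * k) ∘ (fun k : G => g⁻¹ * k) = id := by ext; simp
  have h1 : HasMFDerivAt J J (fun k : G => g⁻¹ * k) g (maurerCartan J g) :=
    (mdifferentiableAt_mul_left g⁻¹ g).hasMFDerivAt
  have h2 : HasMFDerivAt J J (fun k : G => g * k) (g⁻¹ * g)
    (mfderiv J J (fun k : G => g * k) (g⁻¹ * g)) :=
    (mdifferentiableAt_mul_left g (g⁻¹ * g)).hasMFDerivAt
  have h3 := h2.comp g h1
  rw [h] at h3
  have h4 := hasMFDerivAt_unique h3 (hasMFDerivAt_id g)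
  have h5 := congrArg (fun T : TangentSpace J g →L[ℝ] TangentSpace J g => T v) h4
  -- The outer derivative is taken at `g⁻¹ * g`, which is only propositionally the identity.
  rw [inv_mul_cancel] at h5
  exact h5

theorem maurerCartan_mulInvariantVectorField (g : G) (v : GroupLieAlgebra J G) :
    maurerCartan J g (mulInvariantVectorField v g) = v := by
  have h : (fun k : G => g⁻¹ * k) ∘ (fun k : G => g * k) = id := by ext; simp
  have h1 : HasMFDerivAt J J (fun k : G => g * k) 1 (mfderiv J J (fun k : G => g * k) 1) :=
    (mdifferentiableAt_mul_left g 1).hasMFDerivAt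
  have h2 : HasMFDerivAt J J (fun k : G => g⁻¹ * k) (g * 1)
    (mfderiv J J (fun k : G => g⁻¹ * k) (g * 1)) :=
    (mdifferentiableAt_mul_left g⁻¹ (g * 1)).hasMFDerivAt
  have h3 := h2.comp 1 h1
  rw [h] at h3
  have h4 := hasMFDerivAt_unique h3 (hasMFDerivAt_id 1)
  have h5 := congrArg (fun T : TangentSpace J (1 : G) →L[ℝ] TangentSpace J (1 : G) => T v) h4
  rw [mul_one] at h5
  exact h5

/-- The tangent map of the multiplication of `G`, written as the sum of its two partial derivatives,
is smooth. -/
theorem contMDiff_tangentMap_mul :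
    ContMDiff (J.tangent.prod J.tangent) J.tangent ∞
      (fun p : TangentBundle J G × TangentBundle J G =>
        (⟨p.1.1 * p.2.1, mfderiv J J (fun k : G => k * p.2.1) p.1.1 p.1.2 +
          mfderiv J J (fun k : G => p.1.1 * k) p.2.1 p.2.2⟩ : TangentBundle J G)) := by
  have h : ContMDiff (J.prod J).tangent J.tangent ∞
      (tangentMap (J.prod J) J fun p : G × G => p.1 * p.2) :=
    (contMDiff_mul J ∞).contMDiff_tangentMap (m := ∞) (by rfl)
  have h' := h.comp (contMDiff_equivTangentBundleProd_symm (I := J) (M := G) (I' := J) (M' := G))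
  refine h'.congr fun p => ?_
  have := mfderiv_prod_eq_add_apply (I := J) (I' := J) (I'' := J)
    (f := fun p : G × G => p.1 * p.2) (p := (p.1.1, p.2.1)) (v := (p.1.2, p.2.2))
    ((contMDiff_mul J ∞ (G := G)).mdifferentiableAt (by simp))
  exact congrArg (TotalSpace.mk (E := fun g : G => TangentSpace J g) (p.1.1 * p.2.1)) this.symm

/-- On a smooth Lie group the left-invariant fields are smooth, and not only `C^2`; this is what
makes them admissible in `IsLeftInvariant`. -/
theorem contMDiff_infty_mulInvariantVectorField (v : GroupLieAlgebra J G) :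
    CMDiff ∞ (T% (mulInvariantVectorField v : Π g : G, TangentSpace J g)) := by
  have h := (contMDiff_tangentMap_mul (J := J) (G := G)).comp
    ((contMDiff_zeroSection ℝ (TangentSpace J : G → Type _)).prodMk
      (contMDiff_const (c := (⟨1, v⟩ : TangentBundle J G))))
  refine h.congr fun g => ?_
  refine (tangentBundle_mk_congr (mul_one g).symm _).trans
    (congrArg (TotalSpace.mk (E := fun g : G => TangentSpace J g) (g * 1)) ?_)
  exact ((congrArg (· + _) (map_zero _)).trans (zero_add _)).symm

/-- The Maurer-Cartan form is smooth as a map from `TG` to the model space `E'` of `𝔤`: it is the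
map `(g, v) ↦ dm ((g⁻¹, 0), (g, v))`, where `m` is the multiplication. -/
theorem contMDiff_maurerCartan :
    ContMDiff (M' := E') J.tangent 𝓘(ℝ, E') ∞
      (fun p : TangentBundle J G => maurerCartan J p.1 p.2) := by
  have hp : ContMDiff J.tangent J ∞ (fun p : TangentBundle J G => p.1) :=
    contMDiff_proj (TangentSpace J : G → Type _)
  have S := (contMDiff_tangentMap_mul (J := J) (G := G)).comp
    (((contMDiff_zeroSection ℝ (TangentSpace J : G → Type _)).comp
      (hp.inv (n := ∞))).prodMk contMDiff_id)
  have hS : ContMDiff J.tangent J.tangent ∞ fun p : TangentBundle J G =>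
      (⟨1, maurerCartan J p.1 p.2⟩ : TangentBundle J G) := by
    refine S.congr fun p => ?_
    refine (tangentBundle_mk_congr (inv_mul_cancel p.1).symm _).trans
      (congrArg (TotalSpace.mk (E := fun g : G => TangentSpace J g) (p.1⁻¹ * p.1)) ?_)
    exact ((congrArg (· + _) (map_zero _)).trans (zero_add _)).symm
  intro p
  have := (contMDiffAt_totalSpace.1 (hS p)).2
  refine this.congr_of_eventuallyEq (Filter.Eventually.of_forall fun q => ?_)
  exact ((tangentBundleCore J G).coordChange_self (achart H' 1) 1 (mem_achart_source H' 1) _).symm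

/-- A left-invariant connection is given by its connection function at every point, and not only at
the identity: `∇_{X_v} X_w` is again left invariant. -/
theorem cov_mulInvariantVectorField
    {cov : CovariantDerivative J E' (fun g : G => TangentSpace J g)} (hinv : IsLeftInvariant cov)
    (v w : GroupLieAlgebra J G) (g : G) :
    cov (mulInvariantVectorField w) g (mulInvariantVectorField v g) =
      mulInvariantVectorField (connectionFunction cov v w) g := by
  have : LieGroup J (minSmoothness ℝ 3) G := by
    apply LieGroup.of_le (n := ∞)
    simp only [minSmoothness_of_isRCLikeNormedField]
    exact ENat.LEInfty.out
  have h := hinv g _ (contMDiff_infty_mulInvariantVectorField w) 1 v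
  rw [mpullback_mulInvariantVectorField] at h
  have h1 : mulInvariantVectorField v (1 : G) = v := by
    have e : (fun k : G => 1 * k) = id := by ext; simp
    rw [mulInvariantVectorField, e, mfderiv_id]
    rfl
  have h2 : connectionFunction cov v w = cov (mulInvariantVectorField w) 1 v := by
    rw [connectionFunction, LinearMap.mk₂_apply, h1]
  rw [h2]
  rw [mul_one] at h
  exact h.symm

end

/-! ### Sums of fields along a map -/

section

variable {E : Type*} [NormedAddCommGroup E] [NormedSpace ℝ E]
  {H : Type*} [TopologicalSpace H] {I : ModelWithCorners ℝ E H}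
  {M : Type*} [TopologicalSpace M] [ChartedSpace H M]
  {E' : Type*} [NormedAddCommGroup E'] [NormedSpace ℝ E']
  {H' : Type*} [TopologicalSpace H'] {J : ModelWithCorners ℝ E' H'}
  {N : Type*} [TopologicalSpace N] [ChartedSpace H' N] [IsManifold J ∞ N]

theorem mdifferentiableAt_along_add {F : M → N} {U U' : Π y : M, TangentSpace J (F y)} {x : M}
    (hU : MDifferentiableAt I J.tangent (fun y => (⟨F y, U y⟩ : TangentBundle J N)) x)
    (hU' : MDifferentiableAt I J.tangent (fun y => (⟨F y, U' y⟩ : TangentBundle J N)) x) :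
    MDifferentiableAt I J.tangent (fun y => (⟨F y, (U + U') y⟩ : TangentBundle J N)) x := by
  have hF := mdiffAt_base hU
  refine (mdifferentiableAt_totalSpace (E := fun z : N => TangentSpace J z) J _).2 ⟨hF, ?_⟩
  exact ((mdiffAt_fieldCoord hU).add (mdiffAt_fieldCoord hU')).congr_of_eventuallyEq
    (fieldCoord_add_eventuallyEq hF.continuousAt U U')

theorem mdifferentiableAt_along_smul {F : M → N} {g : M → ℝ} {U : Π y : M, TangentSpace J (F y)}
    {x : M} (hg : MDiffAt g x)
    (hU : MDifferentiableAt I J.tangent (fun y => (⟨F y, U y⟩ : TangentBundle J N)) x) :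
    MDifferentiableAt I J.tangent (fun y => (⟨F y, g y • U y⟩ : TangentBundle J N)) x := by
  have hF := mdiffAt_base hU
  refine (mdifferentiableAt_totalSpace (E := fun z : N => TangentSpace J z) J _).2 ⟨hF, ?_⟩
  exact (hg.smul (mdiffAt_fieldCoord hU)).congr_of_eventuallyEq
    (fieldCoord_smul_eventuallyEq hF.continuousAt g U)

/-- Differentiability of the partial sums is proved along with additivity, which needs it in the
induction step. -/
theorem pullbackConnection_sum [FiniteDimensional ℝ E']
    {cov : CovariantDerivative J E' (fun z : N => TangentSpace J z)}
    {F : M → N} {ι : Type*} (s : Finset ι) {U : ι → Π y : M, TangentSpace J (F y)} {x : M}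
    (hF : MDifferentiableAt I J F x)
    (hU : ∀ i ∈ s, MDifferentiableAt I J.tangent
      (fun y => (⟨F y, U i y⟩ : TangentBundle J N)) x) :
    MDifferentiableAt I J.tangent
      (fun y => (⟨F y, (∑ i ∈ s, U i) y⟩ : TangentBundle J N)) x ∧
    pullbackConnection I cov F (∑ i ∈ s, U i) x = ∑ i ∈ s, pullbackConnection I cov F (U i) x := by
  classical
  induction s using Finset.induction_on with
  | empty =>
    have h0 : MDifferentiableAt I J.tangent
        (fun y => (⟨F y, (0 : Π y : M, TangentSpace J (F y)) y⟩ : TangentBundle J N)) x :=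
      ((contMDiff_zeroSection ℝ (TangentSpace J : N → Type _) (IB := J)
        (n := ∞)).mdifferentiable (by simp) (F x)).comp x hF
    refine ⟨by simpa using h0, ?_⟩
    have := pullbackConnection_add (cov := cov) h0 h0
    simpa using this
  | insert i s hi ih =>
    have h1 := hU i (Finset.mem_insert_self i s)
    obtain ⟨h2, h3⟩ := ih fun j hj => hU j (Finset.mem_insert_of_mem hj)
    rw [Finset.sum_insert hi, Finset.sum_insert hi, pullbackConnection_add h1 h2, h3]
    exact ⟨mdifferentiableAt_along_add h1 h2, rfl⟩

end

/-! ### Fields along a map, expressed by left-invariant fields -/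

section
variable {E : Type*} [NormedAddCommGroup E] [NormedSpace ℝ E]
  {H : Type*} [TopologicalSpace H] {I : ModelWithCorners ℝ E H}
  {M : Type*} [TopologicalSpace M] [ChartedSpace H M]
  {E' : Type*} [NormedAddCommGroup E'] [NormedSpace ℝ E'] [FiniteDimensional ℝ E']
  {H' : Type*} [TopologicalSpace H'] {J : ModelWithCorners ℝ E' H'}
  {G : Type*} [TopologicalSpace G] [ChartedSpace H' G] [Group G] [LieGroup J ∞ G]

theorem mvfderiv_clm_comp {V W : Type*} [NormedAddCommGroup V] [NormedSpace ℝ V]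
    [NormedAddCommGroup W] [NormedSpace ℝ W]
    (c : V →L[ℝ] W) {u : M → V} {x : M} (hu : MDiffAt u x)
    (v : TangentSpace I x) : mvfderiv I (fun y => c (u y)) x v = c (mvfderiv I u x v) := by
  have h := (c.hasMFDerivAt (x := u x)).comp x hu.hasMFDerivAt
  have h' : mfderiv I 𝓘(ℝ, W) (fun y => c (u y)) x = _ := h.mfderiv
  simp only [mvfderiv, h']
  rfl

/-- The induced connection in the left trivialization of `F⁻¹(TG)`: it acts on functions
`u : M → 𝔤` by `∇'_v u = du(v) + α(ω_G(F_* v), u)`. -/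
theorem pullbackConnection_mulInvariantVectorField
    {cov : CovariantDerivative J E' (fun g : G => TangentSpace J g)} (hinv : IsLeftInvariant cov)
    {F : M → G} {x : M} (hF : MDifferentiableAt I J F x) {u : M → E'} (hu : MDiffAt u x)
    (v : TangentSpace I x) :
    pullbackConnection I cov F
        (fun y => mulInvariantVectorField (I := J) (G := G) (u y) (F y)) x v =
      mulInvariantVectorField ((show GroupLieAlgebra J G from mvfderiv I u x v) +
        connectionFunction cov (maurerCartan J (F x) (mfderiv I J F x v)) (u x)) (F x) := by
  -- `u = ∑ uⁱ b_i` with `uⁱ = c i ∘ u` expresses the field by the left-invariant frame. As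
  -- `TangentSpace` is a copy of `E'`, the coordinates serve both `𝔤`-valued and `E'`-valued maps.
  let b : Module.Basis _ ℝ (GroupLieAlgebra J G) := Module.finBasis ℝ E'
  let c (i) : E' →L[ℝ] ℝ := LinearMap.toContinuousLinearMap ((Module.finBasis ℝ E').coord i)
  have hb (w : GroupLieAlgebra J G) : ∑ i, c i w • b i = w := b.sum_repr w
  have hX (i) : MDifferentiableAt I J.tangent
      (fun y => (⟨F y, mulInvariantVectorField (b i) (F y)⟩ : TangentBundle J G)) x :=
    (mdiffAt_mulInvariantVectorField (b i) (F x)).comp x hF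
  have hc (i) : MDiffAt (fun y => c i (u y)) x :=
    (c i).mdifferentiableAt.comp x hu
  have hU : (fun y => mulInvariantVectorField (I := J) (G := G) (u y) (F y)) =
      ∑ i, fun y => c i (u y) • mulInvariantVectorField (b i) (F y) := by
    funext y
    rw [Finset.sum_apply]
    conv_lhs => rw [← hb (u y)]
    simp only [mulInvariantVectorField, map_sum, map_smul]
    rfl
  rw [hU, (pullbackConnection_sum Finset.univ hF
    fun i _ => mdifferentiableAt_along_smul (hc i) (hX i)).2]
  have hv : mfderiv I J F x v =
      mulInvariantVectorField (maurerCartan J (F x) (mfderiv I J F x v)) (F x) :=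
    (mulInvariantVectorField_maurerCartan _ _).symm
  have hi (i) : pullbackConnection I cov F
        (fun y => c i (u y) • mulInvariantVectorField (b i) (F y)) x v =
      mulInvariantVectorField (c i (mvfderiv I u x v) • b i + c i (u x) •
        connectionFunction cov (maurerCartan J (F x) (mfderiv I J F x v)) (b i)) (F x) := by
    rw [pullbackConnection_smul (hc i) (hX i),
      pullbackConnection_comp hF (mdiffAt_mulInvariantVectorField (b i) (F x)),
      mulInvariantVectorField_add, mulInvariantVectorField_smul, mulInvariantVectorField_smul,
      Pi.add_apply, Pi.smul_apply, Pi.smul_apply, ← cov_mulInvariantVectorField hinv, ← hv,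
      add_apply, smul_apply, ContinuousLinearMap.smulRight_apply, mvfderiv_clm_comp (c i) hu,
      add_comm]
    rfl
  -- Both sides are linear in the values at the basis `b`; `T` will be left translation and `A` will
  -- be `α(ω_G(F_* v), ·)`.
  have key (T : GroupLieAlgebra J G →L[ℝ] TangentSpace J (F x))
      (A : GroupLieAlgebra J G →ₗ[ℝ] GroupLieAlgebra J G) (p q : GroupLieAlgebra J G) :
      ∑ i, T (c i p • b i + c i q • A (b i)) = T (p + A q) := by
    have hA : A q = ∑ i, c i q • A (b i) := by
      conv_lhs => rw [← hb q, map_sum]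
      exact Finset.sum_congr rfl fun i _ => map_smul _ _ _
    conv_rhs => rw [hA, ← hb p]
    rw [← map_sum, Finset.sum_add_distrib]
  rw [sum_apply, Finset.sum_congr rfl fun i _ => hi i]
  exact key _ _ _ _

end

/-! ### The second fundamental form and the tension field in the left trivialization -/

section
variable {E : Type*} [NormedAddCommGroup E] [NormedSpace ℝ E]
  {H : Type*} [TopologicalSpace H] {I : ModelWithCorners ℝ E H}
  {M : Type*} [TopologicalSpace M] [ChartedSpace H M] [IsManifold I ∞ M]
  {E' : Type*} [NormedAddCommGroup E'] [NormedSpace ℝ E'] [FiniteDimensional ℝ E']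
  {H' : Type*} [TopologicalSpace H'] {J : ModelWithCorners ℝ E' H'}
  {G : Type*} [TopologicalSpace G] [ChartedSpace H' G] [Group G] [LieGroup J ∞ G]

/-- In the left trivialization the second fundamental form is `∇η + α(η, η)`, with
`η = F^* ω_G`. -/
theorem secondFundamentalForm_eq
    (covM : CovariantDerivative I E (fun x : M => TangentSpace I x))
    {covG : CovariantDerivative J E' (fun g : G => TangentSpace J g)} (hinv : IsLeftInvariant covG)
    {F : M → G} (hF : ContMDiff I J ∞ F) (X : Π x : M, TangentSpace I x)
    {Y : Π x : M, TangentSpace I x} {x : M} (hY : MDiffAt (T% Y) x) :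
    secondFundamentalForm covM covG F X Y x =
      mulInvariantVectorField
        ((show GroupLieAlgebra J G from covDerivOneForm (V := E') covM
          (fun y => (maurerCartan J (F y)).comp (mfderiv I J F y)) X Y x) +
        connectionFunction covG (maurerCartan J (F x) (mfderiv I J F x (X x)))
          (maurerCartan J (F x) (mfderiv I J F x (Y x)))) (F x) := by
  have hFx : MDifferentiableAt I J F x := hF.mdifferentiableAt (by simp)
  have hu : MDifferentiableAt (M' := E') I 𝓘(ℝ, E')
      (fun y => maurerCartan J (F y) (mfderiv I J F y (Y y))) x :=
    (((contMDiff_maurerCartan (J := J) (G := G)).mdifferentiable (by simp))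
      (⟨F x, mfderiv I J F x (Y x)⟩ : TangentBundle J G)).comp x (mdiffAt_mfderiv_apply hF hY)
  have h := pullbackConnection_mulInvariantVectorField hinv hFx hu (X x)
  have h1 : (fun y => mfderiv I J F y (Y y)) = fun y => mulInvariantVectorField
      (maurerCartan J (F y) (mfderiv I J F y (Y y))) (F y) :=
    funext fun y => (mulInvariantVectorField_maurerCartan _ _).symm
  have h2 := mulInvariantVectorField_maurerCartan (F x) (mfderiv I J F x (covM Y x (X x)))
  rw [secondFundamentalForm, h1]
  refine (congrArg₂ (· - ·) h h2.symm).trans ?_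
  refine (map_sub (mfderiv J J (fun k : G => F x * k) 1) _ _).symm.trans ?_
  exact congrArg (mfderiv J J (fun k : G => F x * k) 1) (add_sub_right_comm _ _ _)

variable (I) [RiemannianBundle (fun x : M => TangentSpace I x)]
  [IsContMDiffRiemannianBundle I ∞ E (fun x : M => TangentSpace I x)] [FiniteDimensional ℝ E]

/-- For a skew-symmetric connection function, the tension field is `-d^* F^* ω_G` in the left
trivialization. -/
theorem tensionField_eq
    {covG : CovariantDerivative J E' (fun g : G => TangentSpace J g)} (hinv : IsLeftInvariant covG)
    (hskew : ∀ v w : GroupLieAlgebra J G,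
      connectionFunction covG v w = -connectionFunction covG w v)
    {F : M → G} (hF : ContMDiff I J ∞ F) (x : M) :
    tensionField I covG F x =
      mulInvariantVectorField (-(show GroupLieAlgebra J G from codifferential I (V := E')
        (fun y => (maurerCartan J (F y)).comp (mfderiv I J F y)) x)) (F x) := by
  have h0 (v : GroupLieAlgebra J G) : connectionFunction covG v v = 0 := by
    have h := hskew v v
    rw [eq_neg_iff_add_eq_zero, ← two_smul ℝ] at h
    rw [← one_smul ℝ (connectionFunction covG v v), show (1 : ℝ) = 2⁻¹ * 2 by norm_num, mul_smul, h,
      smul_zero]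
  have h1 (v : TangentSpace I x) :
      secondFundamentalForm (leviCivita I) covG F (extend E v) (extend E v) x =
        mulInvariantVectorField (show GroupLieAlgebra J G from covDerivOneForm (V := E')
          (leviCivita I) (fun y => (maurerCartan J (F y)).comp (mfderiv I J F y))
          (extend E v) (extend E v) x) (F x) := by
    refine (secondFundamentalForm_eq (leviCivita I) hinv hF _
      (mdifferentiableAt_extend I E v)).trans ?_
    rw [h0, add_zero]
  refine (Finset.sum_congr rfl fun i _ => h1 _).trans ?_
  refine (map_sum (mfderiv J J (fun k : G => F x * k) 1) _ _).symm.trans ?_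
  exact congrArg (mfderiv J J (fun k : G => F x * k) 1) (neg_neg _).symm

end

end Pluzhnikov

theorem mainTheorem1
    {E : Type*} [NormedAddCommGroup E] [NormedSpace ℝ E] [FiniteDimensional ℝ E]
    {H : Type*} [TopologicalSpace H] (I : ModelWithCorners ℝ E H)
    {M : Type*} [TopologicalSpace M] [ChartedSpace H M] [IsManifold I ∞ M]
    [RiemannianBundle (fun x : M => TangentSpace I x)]
    [IsContMDiffRiemannianBundle I ∞ E (fun x : M => TangentSpace I x)]
    {E' : Type*} [NormedAddCommGroup E'] [NormedSpace ℝ E'] [FiniteDimensional ℝ E']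
    {H' : Type*} [TopologicalSpace H'] (J : ModelWithCorners ℝ E' H')
    {G : Type*} [TopologicalSpace G] [ChartedSpace H' G] [Group G] [LieGroup J ∞ G]
    (covG : CovariantDerivative J E' (fun g : G => TangentSpace J g))
    (hinv : Pluzhnikov.IsLeftInvariant covG)
    (hskew : ∀ v w : GroupLieAlgebra J G,
      Pluzhnikov.connectionFunction covG v w = -Pluzhnikov.connectionFunction covG w v)
    (F : M → G) (hF : ContMDiff I J ∞ F) :
    Pluzhnikov.IsHarmonic I covG F ↔
      ∀ x : M, Pluzhnikov.codifferential I (V := E')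
        (fun y => (Pluzhnikov.maurerCartan J (F y)).comp (mfderiv I J F y)) x = 0 := by
  refine forall_congr' fun x => ?_
  rw [Pluzhnikov.tensionField_eq I hinv hskew hF x]
  constructor
  · intro h
    have h1 := congrArg (Pluzhnikov.maurerCartan J (F x)) h
    rw [Pluzhnikov.maurerCartan_mulInvariantVectorField, map_zero] at h1
    exact neg_eq_zero.1 h1
  · intro h
    rw [mulInvariantVectorField]
    exact (congrArg _ (neg_eq_zero.2 h)).trans (map_zero _)
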